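/- Let $K$ be a field. A system $(E,A)$ is a pair of linear maps $E,A\colon M\to V$ between finite-dimensional $K$-vector spaces. Put $V' := EM$ and $M' := A^{-1}(V') = \{x\in M : Ax\in V'\}$. Then $E$ and $A$ map $M'$ into $V'$, and their restrictions $E',A'\colon M'\to V'$ form the reduced system $(E,A)' := (E',A')$. Let $(E,A)^{(0)} := (E,A)$ and $(E,A)^{(k+1)} := ((E,A)^{(k)})'$. A system is totally reduced if $M'=M$ and $V'=V$. For the smallest $n\in\mathbf N$ such that $(E,A)^{(n)}$ is totally reduced (such an $n$ exists), put $(E^{(\infty)},A^{(\infty)}) := (E,A)^{(n)}$. Let $V'' := EM'$ and let $[A]\colon M/M'\to V/V'$ and $[E]\colon M/M'\to V'/V''$ be the linear maps induced by $A$ and by $E$. Put $\alpha_1(E,A) := \dim\ker[E]$ and $\beta_1^+(E,A) := \dim\operatorname{coker}[A]$. For every integer $k\ge 1$ define - the constraint defects $\alpha_k(E,A) := \alpha_1\bigl((E,A)^{(k-1)}\bigr)$, - the observation defects $\beta_k^+(E,A) := \beta_1^+\bigl((E,A)^{(k-1)}\bigr)$, - the control defects $\beta_k^-(E,A) := \beta_k^+\bigl(E^{(\infty)*},A^{(\infty)*}\bigr)$,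 where $E^*,A^*\colon V^*\to M^*$ denote the transposes of $E,A$ between the dual vector spaces, which form the dual system. **Theorem 8.7.** For every system $(E,A)$ and every integer $k\ge 1$, $$\alpha_k(E^*,A^*)=\alpha_k(E,A),\qquad \beta_k^+(E^*,A^*)=\beta_k^-(E,A),\qquad \beta_k^-(E^*,A^*)=\beta_k^+(E,A).$$ -/

import Mathlib

universe u v w

/-- A linear system over a field `K`: two linear maps `E`, `A` with the same finite-dimensional
domain `M` and the same finite-dimensional codomain `V`. -/
structure LinearSystem (K : Type u) [Field K] where
  /-- the common domain -/
  M : Type v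
  /-- the common codomain -/
  V : Type w
  [addCommGroupM : AddCommGroup M]
  [moduleM : Module K M]
  [finiteM : FiniteDimensional K M]
  [addCommGroupV : AddCommGroup V]
  [moduleV : Module K V]
  [finiteV : FiniteDimensional K V]
  /-- the first operator -/
  E : M →ₗ[K] V
  /-- the second operator -/
  A : M →ₗ[K] V

namespace LinearSystem

attribute [instance] addCommGroupM moduleM finiteM addCommGroupV moduleV finiteV

/-- The system given by a pair of linear maps. -/
def ofPair {K : Type u} [Field K] {M : Type v} {V : Type w}
    [AddCommGroup M] [Module K M] [FiniteDimensional K M]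
    [AddCommGroup V] [Module K V] [FiniteDimensional K V]
    (E A : M →ₗ[K] V) : LinearSystem.{u, v, w} K where
  M := M
  V := V
  E := E
  A := A

variable {K : Type u} [Field K]

/-- The reduced codomain `V' = E M`. -/
def redV (S : LinearSystem.{u, v, w} K) : Submodule K S.V :=
  LinearMap.range S.E

/-- The reduced domain `M' = A⁻¹ V'` (preimage). -/
def redM (S : LinearSystem.{u, v, w} K) : Submodule K S.M :=
  S.redV.comap S.A

/-- The reduced system `(E', A')`: the restrictions of `E` and `A` to maps `M' → V'`. -/
def reduced (S : LinearSystem.{u, v, w} K) : LinearSystem.{u, v, w} K :=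
  ofPair (M := S.redM) (V := S.redV)
    (S.E.restrict fun x _ => LinearMap.mem_range_self S.E x)
    (S.A.restrict fun _ hx => hx)

/-- The iterated reductions: `iter S k` is `(E⁽ᵏ⁾, A⁽ᵏ⁾)`. -/
def iter (S : LinearSystem.{u, v, w} K) : ℕ → LinearSystem.{u, v, w} K
  | 0 => S
  | k + 1 => (S.iter k).reduced

/-- A system is totally reduced if it coincides with its reduced system, that is, if the subspaces
`M'` and `V'` are the whole of `M` and `V`. -/
def IsTotallyReduced (S : LinearSystem.{u, v, w} K) : Prop :=
  S.redM = ⊤ ∧ S.redV = ⊤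

/-- The reduction procedure ends after finitely many steps. -/
theorem exists_isTotallyReduced_iter (S : LinearSystem.{u, v, w} K) :
    ∃ n, (S.iter n).IsTotallyReduced := by
  by_contra! h
  have step : ∀ n, Module.finrank K (S.iter (n + 1)).V < Module.finrank K (S.iter n).V := by
    intro n
    refine Submodule.finrank_lt fun hV => h n ⟨?_, hV⟩
    change Submodule.comap _ (S.iter n).redV = ⊤
    rw [hV, Submodule.comap_top]
  have key : ∀ n, Module.finrank K (S.iter n).V + n ≤ Module.finrank K S.V := by
    intro n
    induction n with
    | zero => exact le_rfl
    | succ n ih => have := step n; omega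
  have := key (Module.finrank K S.V + 1)
  omega

open Classical in
/-- The index: the smallest `n` for which `(E⁽ⁿ⁾, A⁽ⁿ⁾)` is totally reduced. -/
noncomputable def index (S : LinearSystem.{u, v, w} K) : ℕ :=
  Nat.find S.exists_isTotallyReduced_iter

/-- The totally reduced system `(E⁽∞⁾, A⁽∞⁾)`. -/
noncomputable def totallyReduced (S : LinearSystem.{u, v, w} K) : LinearSystem.{u, v, w} K :=
  S.iter S.index

/-- The dual system `(E*, A*)`, consisting of the transposes `V* → M*`. -/
def dual (S : LinearSystem.{u, v, w} K) : LinearSystem.{u, max u w, max u v} K :=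
  ofPair S.E.dualMap S.A.dualMap

/-- The quotient operator `[A] : M / M' → V / V'` induced by `A`. -/
def quotA (S : LinearSystem.{u, v, w} K) : (S.M ⧸ S.redM) →ₗ[K] (S.V ⧸ S.redV) :=
  S.redM.mapQ S.redV S.A le_rfl

/-- The subspace `V'' = E' M'` of `V'`. -/
def redV₂ (S : LinearSystem.{u, v, w} K) : Submodule K S.redV :=
  S.reduced.redV

/-- `E`, regarded as a map from `M` to `V'`, sends `M'` into `V''`. -/
theorem redM_le_comap_redV₂ (S : LinearSystem.{u, v, w} K) :
    S.redM ≤ S.redV₂.comap S.E.rangeRestrict :=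
  fun x hx => ⟨⟨x, hx⟩, rfl⟩

/-- The quotient operator `[E] : M / M' → V' / V''` induced by `E`. -/
def quotE (S : LinearSystem.{u, v, w} K) : (S.M ⧸ S.redM) →ₗ[K] (S.redV ⧸ S.redV₂) :=
  S.redM.mapQ S.redV₂ S.E.rangeRestrict S.redM_le_comap_redV₂

/-- The first constraint defect `α₁ = dim ker [E]`. -/
noncomputable def alphaOne (S : LinearSystem.{u, v, w} K) : ℕ :=
  Module.finrank K (LinearMap.ker S.quotE)

/-- The first observation defect `β₁⁺ = dim coker [A]`. -/
noncomputable def betaPlusOne (S : LinearSystem.{u, v, w} K) : ℕ :=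
  Module.finrank K ((S.V ⧸ S.redV) ⧸ LinearMap.range S.quotA)

/-- The constraint defects `αₖ`, meaningful for `k ≥ 1`. -/
noncomputable def alpha (S : LinearSystem.{u, v, w} K) (k : ℕ) : ℕ :=
  (S.iter (k - 1)).alphaOne

/-- The observation defects `βₖ⁺`, meaningful for `k ≥ 1`. -/
noncomputable def betaPlus (S : LinearSystem.{u, v, w} K) (k : ℕ) : ℕ :=
  (S.iter (k - 1)).betaPlusOne

/-- The control defects `βₖ⁻`, meaningful for `k ≥ 1`: the observation defects of the dual of the
totally reduced system. -/
noncomputable def betaMinus (S : LinearSystem.{u, v, w} K) (k : ℕ) : ℕ :=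
  S.totallyReduced.dual.betaPlus k

end LinearSystem

/-! Write Vₖ, Mₖ = A⁻¹Vₖ and Nₖ for `codomainChain`, `domainChain` and `kernelChain`. Every defect
is a difference of consecutive dimensions: αₖ₊₁ comes from ker E ∩ Mₖ (`alpha_succ_add_finrank`),
βₖ₊₁⁺ from Vₖ + AM (`betaPlus_succ_add_finrank_sup_range`). Dualizing replaces Vₖ by the annihilator
of Nₖ, so βₖ₊₁⁺ of the dual comes from Nₖ ∩ ker A.

Since ker A ⊆ M', reduction leaves Nₖ ∩ ker A unchanged. Hence the control defects may be computed
from the dual of the original system (`betaMinus_succ`), and both β identities follow, the second by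
dualizing twice.

For α, the dual defects come from the annihilator of EM + ANₖ, so dim(EM + ANₖ) must grow as dim(ker
E ∩ Mₖ) falls. This is `finrank_range_sup_map_kernelChain`, which rests on counting dim(Nᵢ ∩ Mⱼ)
along i + j constant. -/

open Module

/-! ### Dimensions and annihilators of images and preimages -/

namespace Submodule

variable {K : Type*} [Field K] {M V : Type*} [AddCommGroup M] [Module K M] [AddCommGroup V]
  [Module K V]

theorem finrank_map_add_finrank_inf_ker [FiniteDimensional K M] (f : M →ₗ[K] V)
    (p : Submodule K M) :
    finrank K (p.map f) + finrank K (p ⊓ LinearMap.ker f : Submodule K M) = finrank K p := by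
  have h := LinearMap.finrank_range_add_finrank_ker (f.domRestrict p)
  rw [LinearMap.range_domRestrict, LinearMap.ker_domRestrict] at h
  rw [← h, ← map_comap_subtype, finrank_map_subtype_eq]

theorem finrank_map_eq_of_injective {f : M →ₗ[K] V} (hf : Function.Injective f)
    (p : Submodule K M) : finrank K (p.map f) = finrank K p :=
  (p.equivMapOfInjective f hf).finrank_eq.symm

/-- The composite M → V → V/p has kernel f⁻¹p, and the range of its transpose is the annihilator of
that kernel. -/
theorem map_dualMap_dualAnnihilator (f : M →ₗ[K] V) (p : Submodule K V) :
    p.dualAnnihilator.map f.dualMap = (p.comap f).dualAnnihilator := by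
  have h := LinearMap.range_dualMap_eq_dualAnnihilator_ker (p.mkQ ∘ₗ f)
  rw [LinearMap.ker_comp, ker_mkQ, ← LinearMap.dualMap_comp_dualMap, LinearMap.range_comp,
    range_dualMap_mkQ_eq] at h
  exact h

theorem comap_dualMap_dualAnnihilator (f : M →ₗ[K] V) (p : Submodule K M) :
    p.dualAnnihilator.comap f.dualMap = (p.map f).dualAnnihilator := by
  ext φ
  simp [mem_dualAnnihilator]

end Submodule

namespace LinearSystem

/-! ### Subspace chains of a pair, their duality and dimension count -/

section Chains

variable {K : Type*} [Field K] {M V : Type*} [AddCommGroup M] [Module K M] [AddCommGroup V]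
  [Module K V] (E A : M →ₗ[K] V)

/-- The subspaces `V ⊇ EM ⊇ …` underlying the codomains of the iterated reductions. -/
def codomainChain : ℕ → Submodule K V
  | 0 => ⊤
  | k + 1 => ((codomainChain k).comap A).map E

/-- The subspaces `M ⊇ A⁻¹EM ⊇ …` underlying the domains of the iterated reductions. -/
def domainChain (k : ℕ) : Submodule K M :=
  (codomainChain E A k).comap A

/-- The subspaces `0 ⊆ ker E ⊆ E⁻¹A(ker E) ⊆ …`, whose annihilators are the codomains of the
iterated reductions of the dual pair. -/
def kernelChain : ℕ → Submodule K M
  | 0 => ⊥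
  | k + 1 => ((kernelChain k).map A).comap E

theorem codomainChain_succ (k : ℕ) :
    codomainChain E A (k + 1) = (domainChain E A k).map E := rfl

theorem kernelChain_succ (k : ℕ) :
    kernelChain E A (k + 1) = ((kernelChain E A k).map A).comap E := rfl

theorem domainChain_zero : domainChain E A 0 = ⊤ := rfl

theorem codomainChain_succ_le (k : ℕ) : codomainChain E A (k + 1) ≤ codomainChain E A k := by
  induction k with
  | zero => exact le_top
  | succ k ih => exact Submodule.map_mono (Submodule.comap_mono ih)

theorem domainChain_succ_le (k : ℕ) : domainChain E A (k + 1) ≤ domainChain E A k :=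
  Submodule.comap_mono (codomainChain_succ_le E A k)

theorem codomainChain_dualMap (k : ℕ) :
    codomainChain E.dualMap A.dualMap k = (kernelChain E A k).dualAnnihilator := by
  induction k with
  | zero => simp [codomainChain, kernelChain]
  | succ k ih =>
    rw [codomainChain, ih, Submodule.comap_dualMap_dualAnnihilator,
      Submodule.map_dualMap_dualAnnihilator, kernelChain]

theorem domainChain_dualMap (k : ℕ) :
    domainChain E.dualMap A.dualMap k = ((kernelChain E A k).map A).dualAnnihilator := by
  rw [domainChain, codomainChain_dualMap, Submodule.comap_dualMap_dualAnnihilator]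

theorem kernelChain_dualMap (k : ℕ) :
    kernelChain E.dualMap A.dualMap k = (codomainChain E A k).dualAnnihilator := by
  induction k with
  | zero => simp [codomainChain, kernelChain]
  | succ k ih =>
    rw [kernelChain, ih, Submodule.map_dualMap_dualAnnihilator,
      Submodule.comap_dualMap_dualAnnihilator, codomainChain]

variable [FiniteDimensional K M]

/-- E on Nᵢ₊₁ ∩ Mⱼ and A on Nᵢ ∩ Mⱼ₊₁ have the same image ANᵢ ∩ Vⱼ₊₁. Their kernels are ker E ∩ Mⱼ
and Nᵢ ∩ ker A, because ker E ⊆ Nᵢ₊₁ and ker A ⊆ Mⱼ₊₁. -/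
theorem finrank_kernelChain_inf_domainChain (i j : ℕ) :
    finrank K (kernelChain E A (i + 1) ⊓ domainChain E A j : Submodule K M) +
        finrank K (kernelChain E A i ⊓ LinearMap.ker A : Submodule K M) =
      finrank K (kernelChain E A i ⊓ domainChain E A (j + 1) : Submodule K M) +
        finrank K (LinearMap.ker E ⊓ domainChain E A j : Submodule K M) := by
  have hE := Submodule.finrank_map_add_finrank_inf_ker E
    (kernelChain E A (i + 1) ⊓ domainChain E A j)
  have hA := Submodule.finrank_map_add_finrank_inf_ker A
    (kernelChain E A i ⊓ domainChain E A (j + 1))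
  have hkE : kernelChain E A (i + 1) ⊓ domainChain E A j ⊓ LinearMap.ker E =
      LinearMap.ker E ⊓ domainChain E A j := by
    rw [inf_comm, ← inf_assoc, kernelChain_succ, inf_eq_left.2 (LinearMap.ker_le_comap E)]
  have hkA : kernelChain E A i ⊓ domainChain E A (j + 1) ⊓ LinearMap.ker A =
      kernelChain E A i ⊓ LinearMap.ker A := by
    rw [inf_assoc, domainChain, inf_eq_right.2 (LinearMap.ker_le_comap A)]
  rw [hkE, inf_comm (kernelChain E A (i + 1)), kernelChain_succ,
    ← Submodule.map_inf_eq_map_inf_comap, inf_comm (domainChain E A j)] at hE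
  rw [hkA, domainChain, ← Submodule.map_inf_eq_map_inf_comap, codomainChain_succ, inf_comm,
    ← codomainChain_succ, ← domainChain] at hA
  rw [← codomainChain_succ, ← kernelChain_succ] at hE
  omega

/-- Iterating the exchange (i + 1, j) → (i, j + 1) ends at N₀ = 0. -/
theorem finrank_kernelChain_inf_domainChain_eq_sum (i j : ℕ) :
    (finrank K (kernelChain E A i ⊓ domainChain E A j : Submodule K M) : ℤ) =
      ∑ l ∈ Finset.range i,
          (finrank K (LinearMap.ker E ⊓ domainChain E A (j + l) : Submodule K M) : ℤ) -
        ∑ l ∈ Finset.range i,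
          (finrank K (kernelChain E A l ⊓ LinearMap.ker A : Submodule K M) : ℤ) := by
  induction i generalizing j with
  | zero => rw [kernelChain, bot_inf_eq]; simp
  | succ i ih =>
    have h := finrank_kernelChain_inf_domainChain E A i j
    have h' := ih (j + 1)
    obtain ⟨g, hg⟩ : ∃ g : ℕ → ℕ, ∀ l,
      finrank K (LinearMap.ker E ⊓ domainChain E A l : Submodule K M) = g l := ⟨_, fun _ => rfl⟩
    rw [Finset.sum_range_succ', Finset.sum_range_succ]
    simp only [hg, add_assoc, add_comm 1, add_zero] at h h' ⊢
    omega

/-- At j = 0, where M₀ = M, consecutive sum formulas differ by their last terms only. -/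
theorem finrank_kernelChain_succ (k : ℕ) :
    finrank K (kernelChain E A (k + 1)) +
        finrank K (kernelChain E A k ⊓ LinearMap.ker A : Submodule K M) =
      finrank K (kernelChain E A k) +
        finrank K (LinearMap.ker E ⊓ domainChain E A k : Submodule K M) := by
  have h := finrank_kernelChain_inf_domainChain_eq_sum E A k 0
  have h' := finrank_kernelChain_inf_domainChain_eq_sum E A (k + 1) 0
  rw [domainChain_zero, inf_top_eq] at h h'
  rw [Finset.sum_range_succ, Finset.sum_range_succ, zero_add] at h'
  omega

/-- Modulo `EM`, the space `A Nₖ` has the dimension of `ker E` modulo `Mₖ`. -/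
theorem finrank_range_sup_map_kernelChain [FiniteDimensional K V] (k : ℕ) :
    finrank K (LinearMap.range E ⊔ (kernelChain E A k).map A : Submodule K V) +
        finrank K (LinearMap.ker E ⊓ domainChain E A k : Submodule K M) =
      finrank K (LinearMap.range E) + finrank K (LinearMap.ker E) := by
  have hsup := Submodule.finrank_sup_add_finrank_inf_eq (LinearMap.range E)
    ((kernelChain E A k).map A)
  have hE := Submodule.finrank_map_add_finrank_inf_ker E (kernelChain E A (k + 1))
  have hkE : kernelChain E A (k + 1) ⊓ LinearMap.ker E = LinearMap.ker E :=
    inf_eq_right.2 (LinearMap.ker_le_comap E)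
  have hA := Submodule.finrank_map_add_finrank_inf_ker A (kernelChain E A k)
  have hk := finrank_kernelChain_succ E A k
  -- ENₖ₊₁ is exactly EM ∩ ANₖ, the intersection in the formula for the sum.
  rw [hkE, kernelChain_succ, Submodule.map_comap_eq, ← kernelChain_succ] at hE
  omega

end Chains

/-! ### Defects as dimension differences, and their behaviour under duality -/

section Defects

variable {K : Type u} [Field K]

/-- ker [E] is the image of ker E in M/M': if Ex = Em with m ∈ M', then x − m lies in ker E and has
the class of x. -/
theorem alphaOne_add_finrank (S : LinearSystem.{u, v, w} K) :
    S.alphaOne + finrank K (LinearMap.ker S.E ⊓ S.redM : Submodule K S.M) =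
      finrank K (LinearMap.ker S.E) := by
  have h : LinearMap.ker S.quotE = (LinearMap.ker S.E).map S.redM.mkQ := by
    refine (Submodule.ker_mapQ S.redM S.redV₂ S.E.rangeRestrict S.redM_le_comap_redV₂).trans ?_
    apply le_antisymm
    · rintro _ ⟨x, ⟨⟨m, hm⟩, hx⟩, rfl⟩
      refine ⟨x - m, ?_, ?_⟩
      · have hx' : S.E m = S.E x := congrArg Subtype.val hx
        change S.E (x - m) = 0
        rw [map_sub, hx', sub_self]
      · rw [map_sub, sub_eq_self]
        exact (Submodule.Quotient.mk_eq_zero _).2 hm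
    · refine Submodule.map_mono fun x hx => ?_
      have hx' : S.E.rangeRestrict x = 0 := Subtype.ext hx
      change S.E.rangeRestrict x ∈ S.redV₂
      exact hx' ▸ zero_mem S.redV₂
  have := Submodule.finrank_map_add_finrank_inf_ker S.redM.mkQ (LinearMap.ker S.E)
  rwa [Submodule.ker_mkQ, ← h] at this

theorem betaPlusOne_add_finrank (S : LinearSystem.{u, v, w} K) :
    S.betaPlusOne + finrank K (LinearMap.range S.E ⊔ LinearMap.range S.A : Submodule K S.V) =
      finrank K S.V := by
  have h : LinearMap.range S.quotA = (LinearMap.range S.A).map S.redV.mkQ :=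
    Submodule.range_mapQ ..
  have h₁ := Submodule.finrank_quotient_add_finrank (LinearMap.range S.quotA)
  have h₂ := Submodule.finrank_quotient_add_finrank S.redV
  have h₃ := Submodule.finrank_map_add_finrank_inf_ker S.redV.mkQ (LinearMap.range S.A)
  have h₄ := Submodule.finrank_sup_add_finrank_inf_eq S.redV (LinearMap.range S.A)
  rw [Submodule.ker_mkQ, ← h, inf_comm] at h₃
  rw [betaPlusOne]
  change _ + finrank K (S.redV ⊔ LinearMap.range S.A : Submodule K S.V) = _
  omega

/-- The inclusion of the domain of an iterated reduction. -/
def iterM (S : LinearSystem.{u, v, w} K) : (k : ℕ) → (S.iter k).M →ₗ[K] S.M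
  | 0 => LinearMap.id
  | k + 1 => S.iterM k ∘ₗ (S.iter k).redM.subtype

/-- The inclusion of the codomain of an iterated reduction. -/
def iterV (S : LinearSystem.{u, v, w} K) : (k : ℕ) → (S.iter k).V →ₗ[K] S.V
  | 0 => LinearMap.id
  | k + 1 => S.iterV k ∘ₗ (S.iter k).redV.subtype

theorem iterM_injective (S : LinearSystem.{u, v, w} K) (k : ℕ) :
    Function.Injective (S.iterM k) := by
  induction k with
  | zero => exact Function.injective_id
  | succ k ih => exact ih.comp (S.iter k).redM.injective_subtype

theorem iterV_injective (S : LinearSystem.{u, v, w} K) (k : ℕ) :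
    Function.Injective (S.iterV k) := by
  induction k with
  | zero => exact Function.injective_id
  | succ k ih => exact ih.comp (S.iter k).redV.injective_subtype

theorem iterV_E (S : LinearSystem.{u, v, w} K) (k : ℕ) (x : (S.iter k).M) :
    S.iterV k ((S.iter k).E x) = S.E (S.iterM k x) := by
  induction k with
  | zero => rfl
  | succ k ih => exact ih x.1

theorem iterV_A (S : LinearSystem.{u, v, w} K) (k : ℕ) (x : (S.iter k).M) :
    S.iterV k ((S.iter k).A x) = S.A (S.iterM k x) := by
  induction k with
  | zero => rfl
  | succ k ih => exact ih x.1

theorem range_iterM_and_range_iterV (S : LinearSystem.{u, v, w} K) (k : ℕ) :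
    LinearMap.range (S.iterM k) = domainChain S.E S.A k ∧
      LinearMap.range (S.iterV k) = codomainChain S.E S.A k := by
  induction k with
  | zero => exact ⟨LinearMap.range_id, LinearMap.range_id⟩
  | succ k ih =>
    obtain ⟨hM, hV⟩ := ih
    -- The codomain at k + 1 needs only the domain at k; the domain at k + 1 then uses this new
    -- codomain.
    have hV' : LinearMap.range (S.iterV (k + 1)) = codomainChain S.E S.A (k + 1) := by
      rw [codomainChain_succ, ← hM]
      apply le_antisymm
      · rintro _ ⟨⟨_, x, rfl⟩, rfl⟩
        exact ⟨_, ⟨x, rfl⟩, (S.iterV_E k x).symm⟩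
      · rintro _ ⟨_, ⟨x, rfl⟩, rfl⟩
        exact ⟨⟨_, x, rfl⟩, S.iterV_E k x⟩
    refine ⟨?_, hV'⟩
    apply le_antisymm
    · rintro _ ⟨x, rfl⟩
      change S.A _ ∈ codomainChain S.E S.A (k + 1)
      rw [← hV', ← S.iterV_A (k + 1) x]
      exact ⟨_, rfl⟩
    · intro y hy
      obtain ⟨x, rfl⟩ : y ∈ LinearMap.range (S.iterM k) := hM ▸ domainChain_succ_le S.E S.A k hy
      have hy' : S.A (S.iterM k x) ∈ LinearMap.range (S.iterV (k + 1)) := hV' ▸ hy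
      obtain ⟨v, hv⟩ := hy'
      have hx : (S.iter k).A x = v.1 :=
        S.iterV_injective k ((S.iterV_A k x).trans hv.symm)
      exact ⟨⟨x, show (S.iter k).A x ∈ (S.iter k).redV from hx ▸ v.2⟩, rfl⟩

theorem range_iterM (S : LinearSystem.{u, v, w} K) (k : ℕ) :
    LinearMap.range (S.iterM k) = domainChain S.E S.A k :=
  (S.range_iterM_and_range_iterV k).1

theorem range_iterV (S : LinearSystem.{u, v, w} K) (k : ℕ) :
    LinearMap.range (S.iterV k) = codomainChain S.E S.A k :=
  (S.range_iterM_and_range_iterV k).2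

theorem map_iterM_ker (S : LinearSystem.{u, v, w} K) (k : ℕ) :
    (LinearMap.ker (S.iter k).E).map (S.iterM k) =
      LinearMap.ker S.E ⊓ domainChain S.E S.A k := by
  have h : LinearMap.ker (S.iter k).E = (LinearMap.ker S.E).comap (S.iterM k) := by
    ext x
    rw [Submodule.mem_comap, LinearMap.mem_ker, LinearMap.mem_ker, ← iterV_E,
      map_eq_zero_iff _ (S.iterV_injective k)]
  rw [h, Submodule.map_comap_eq, range_iterM, inf_comm]

theorem map_iterM_redM (S : LinearSystem.{u, v, w} K) (k : ℕ) :
    (S.iter k).redM.map (S.iterM k) = domainChain S.E S.A (k + 1) := by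
  refine Eq.trans ?_ (S.range_iterM (k + 1))
  refine Eq.trans ?_ (LinearMap.range_comp (S.iter k).redM.subtype (S.iterM k)).symm
  rw [Submodule.range_subtype]

theorem map_iterV_range_E (S : LinearSystem.{u, v, w} K) (k : ℕ) :
    (LinearMap.range (S.iter k).E).map (S.iterV k) = codomainChain S.E S.A (k + 1) := by
  refine Eq.trans ?_ (S.range_iterV (k + 1))
  refine Eq.trans ?_ (LinearMap.range_comp (S.iter k).redV.subtype (S.iterV k)).symm
  rw [Submodule.range_subtype]
  rfl

theorem map_iterV_range_A (S : LinearSystem.{u, v, w} K) (k : ℕ) :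
    (LinearMap.range (S.iter k).A).map (S.iterV k) = (domainChain S.E S.A k).map S.A := by
  rw [← range_iterM, ← LinearMap.range_comp, ← LinearMap.range_comp]
  congr 1
  ext x
  exact S.iterV_A k x

theorem alpha_succ_add_finrank (S : LinearSystem.{u, v, w} K) (k : ℕ) :
    S.alpha (k + 1) +
        finrank K (LinearMap.ker S.E ⊓ domainChain S.E S.A (k + 1) : Submodule K S.M) =
      finrank K (LinearMap.ker S.E ⊓ domainChain S.E S.A k : Submodule K S.M) := by
  have hinj := S.iterM_injective k
  rw [← inf_eq_right.2 (domainChain_succ_le S.E S.A k), ← inf_assoc, ← map_iterM_ker,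
    ← map_iterM_redM, ← Submodule.map_inf _ hinj,
    Submodule.finrank_map_eq_of_injective hinj, Submodule.finrank_map_eq_of_injective hinj]
  exact (S.iter k).alphaOne_add_finrank

theorem betaPlus_succ_add_finrank (S : LinearSystem.{u, v, w} K) (k : ℕ) :
    S.betaPlus (k + 1) + finrank K (codomainChain S.E S.A (k + 1) ⊔
        (domainChain S.E S.A k).map S.A : Submodule K S.V) =
      finrank K (codomainChain S.E S.A k) := by
  have hinj := S.iterV_injective k
  rw [← map_iterV_range_A, ← map_iterV_range_E, ← Submodule.map_sup, ← range_iterV,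
    Submodule.finrank_map_eq_of_injective hinj, LinearMap.finrank_range_of_inj hinj]
  exact (S.iter k).betaPlusOne_add_finrank

/-- The observation defects in terms of `Vₖ + AM`. -/
theorem betaPlus_succ_add_finrank_sup_range (S : LinearSystem.{u, v, w} K) (k : ℕ) :
    S.betaPlus (k + 1) +
        finrank K (codomainChain S.E S.A (k + 1) ⊔ LinearMap.range S.A : Submodule K S.V) =
      finrank K (codomainChain S.E S.A k ⊔ LinearMap.range S.A : Submodule K S.V) := by
  have h := S.betaPlus_succ_add_finrank k
  have hle := codomainChain_succ_le S.E S.A k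
  have hsup := Submodule.finrank_sup_add_finrank_inf_eq
    (codomainChain S.E S.A (k + 1) ⊔ LinearMap.range S.A) (codomainChain S.E S.A k)
  -- Modular law: (Vₖ₊₁ + AM) ∩ Vₖ = Vₖ₊₁ + (AM ∩ Vₖ) = Vₖ₊₁ + AMₖ.
  rw [sup_inf_assoc_of_le _ hle, ← Submodule.map_comap_eq, sup_right_comm,
    sup_eq_right.2 hle] at hsup
  change _ + finrank K (_ ⊔ (domainChain S.E S.A k).map S.A : Submodule K S.V) = _ at hsup
  omega

theorem dual_betaPlus_succ_add_finrank (S : LinearSystem.{u, v, w} K) (k : ℕ) :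
    S.dual.betaPlus (k + 1) +
        finrank K (kernelChain S.E S.A k ⊓ LinearMap.ker S.A : Submodule K S.M) =
      finrank K (kernelChain S.E S.A (k + 1) ⊓ LinearMap.ker S.A : Submodule K S.M) := by
  have h : S.dual.betaPlus (k + 1) +
      finrank K (codomainChain S.E.dualMap S.A.dualMap (k + 1) ⊔ LinearMap.range S.A.dualMap :
        Submodule K (Dual K S.M)) =
      finrank K (codomainChain S.E.dualMap S.A.dualMap k ⊔ LinearMap.range S.A.dualMap :
        Submodule K (Dual K S.M)) :=
    S.dual.betaPlus_succ_add_finrank_sup_range k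
  rw [codomainChain_dualMap, codomainChain_dualMap,
    LinearMap.range_dualMap_eq_dualAnnihilator_ker, ← Subspace.dualAnnihilator_inf_eq,
    ← Subspace.dualAnnihilator_inf_eq] at h
  have h₁ := Subspace.finrank_add_finrank_dualAnnihilator_eq
    (kernelChain S.E S.A k ⊓ LinearMap.ker S.A)
  have h₂ := Subspace.finrank_add_finrank_dualAnnihilator_eq
    (kernelChain S.E S.A (k + 1) ⊓ LinearMap.ker S.A)
  omega

theorem map_subtype_kernelChain_reduced (S : LinearSystem.{u, v, w} K) (k : ℕ) :
    (kernelChain S.reduced.E S.reduced.A k).map S.redM.subtype =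
      kernelChain S.E S.A k ⊓ S.redM := by
  induction k with
  | zero => exact (Submodule.map_bot _).trans (bot_inf_eq _).symm
  | succ k ih =>
    apply le_antisymm
    · rintro _ ⟨x, ⟨y, hy, hyx⟩, rfl⟩
      have hy' : y.1 ∈ kernelChain S.E S.A k ⊓ S.redM := ih ▸ ⟨y, hy, rfl⟩
      exact ⟨⟨y.1, hy'.1, congrArg Subtype.val hyx⟩, x.2⟩
    · rintro x ⟨⟨y, hy, hyx⟩, hx⟩
      -- Ay = Ex lies in EM, so the witness y is automatically in M'.
      have hyM : y ∈ S.redM := ⟨x, hyx.symm⟩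
      have hy' : y ∈ (kernelChain S.reduced.E S.reduced.A k).map S.redM.subtype :=
        ih ▸ ⟨hy, hyM⟩
      obtain ⟨z, hz, rfl⟩ := hy'
      exact ⟨⟨x, hx⟩, ⟨z, hz, Subtype.ext hyx⟩, rfl⟩

theorem finrank_kernelChain_reduced_inf_ker (S : LinearSystem.{u, v, w} K) (k : ℕ) :
    finrank K (kernelChain S.reduced.E S.reduced.A k ⊓ LinearMap.ker S.reduced.A :
        Submodule K S.reduced.M) =
      finrank K (kernelChain S.E S.A k ⊓ LinearMap.ker S.A : Submodule K S.M) := by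
  have hker : LinearMap.ker S.reduced.A = (LinearMap.ker S.A).comap S.redM.subtype := by
    ext x
    exact Subtype.ext_iff
  have hle : LinearMap.ker S.A ≤ S.redM := LinearMap.ker_le_comap S.A
  have h : (kernelChain S.reduced.E S.reduced.A k ⊓ LinearMap.ker S.reduced.A).map
      S.redM.subtype = kernelChain S.E S.A k ⊓ LinearMap.ker S.A := by
    rw [hker]
    refine (Submodule.map_inf_eq_map_inf_comap (f := S.redM.subtype)).symm.trans ?_
    refine (congrArg (· ⊓ LinearMap.ker S.A) (S.map_subtype_kernelChain_reduced k)).trans ?_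
    rw [inf_assoc, inf_eq_right.2 hle]
  rw [← h]
  exact (Submodule.finrank_map_eq_of_injective S.redM.injective_subtype _).symm

/-- Reduction does not change the observation defects of the dual system. -/
theorem dual_reduced_betaPlus_succ (S : LinearSystem.{u, v, w} K) (k : ℕ) :
    S.reduced.dual.betaPlus (k + 1) = S.dual.betaPlus (k + 1) := by
  have h := S.dual_betaPlus_succ_add_finrank k
  have h' := S.reduced.dual_betaPlus_succ_add_finrank k
  rw [finrank_kernelChain_reduced_inf_ker, finrank_kernelChain_reduced_inf_ker] at h'
  omega

theorem dual_iter_betaPlus_succ (S : LinearSystem.{u, v, w} K) (n k : ℕ) :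
    (S.iter n).dual.betaPlus (k + 1) = S.dual.betaPlus (k + 1) := by
  induction n with
  | zero => rfl
  | succ n ih => exact ((S.iter n).dual_reduced_betaPlus_succ k).trans ih

theorem betaMinus_succ (S : LinearSystem.{u, v, w} K) (k : ℕ) :
    S.betaMinus (k + 1) = S.dual.betaPlus (k + 1) :=
  S.dual_iter_betaPlus_succ S.index k

theorem dual_dual_betaPlus_succ (S : LinearSystem.{u, v, w} K) (k : ℕ) :
    S.dual.dual.betaPlus (k + 1) = S.betaPlus (k + 1) := by
  have h : S.dual.dual.betaPlus (k + 1) +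
      finrank K (kernelChain S.E.dualMap S.A.dualMap k ⊓ LinearMap.ker S.A.dualMap :
        Submodule K (Dual K S.V)) =
      finrank K (kernelChain S.E.dualMap S.A.dualMap (k + 1) ⊓ LinearMap.ker S.A.dualMap :
        Submodule K (Dual K S.V)) :=
    S.dual.dual_betaPlus_succ_add_finrank k
  rw [kernelChain_dualMap, kernelChain_dualMap, LinearMap.ker_dualMap_eq_dualAnnihilator_range,
    ← Submodule.dualAnnihilator_sup_eq, ← Submodule.dualAnnihilator_sup_eq] at h
  have h₁ := Subspace.finrank_add_finrank_dualAnnihilator_eq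
    (codomainChain S.E S.A k ⊔ LinearMap.range S.A)
  have h₂ := Subspace.finrank_add_finrank_dualAnnihilator_eq
    (codomainChain S.E S.A (k + 1) ⊔ LinearMap.range S.A)
  have h₃ := S.betaPlus_succ_add_finrank_sup_range k
  omega

theorem dual_alpha_succ (S : LinearSystem.{u, v, w} K) (k : ℕ) :
    S.dual.alpha (k + 1) = S.alpha (k + 1) := by
  have h : S.dual.alpha (k + 1) +
      finrank K (LinearMap.ker S.E.dualMap ⊓ domainChain S.E.dualMap S.A.dualMap (k + 1) :
        Submodule K (Dual K S.V)) =
      finrank K (LinearMap.ker S.E.dualMap ⊓ domainChain S.E.dualMap S.A.dualMap k :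
        Submodule K (Dual K S.V)) :=
    S.dual.alpha_succ_add_finrank k
  rw [domainChain_dualMap, domainChain_dualMap, LinearMap.ker_dualMap_eq_dualAnnihilator_range,
    ← Submodule.dualAnnihilator_sup_eq, ← Submodule.dualAnnihilator_sup_eq] at h
  have h₁ := Subspace.finrank_add_finrank_dualAnnihilator_eq
    (LinearMap.range S.E ⊔ (kernelChain S.E S.A k).map S.A)
  have h₂ := Subspace.finrank_add_finrank_dualAnnihilator_eq
    (LinearMap.range S.E ⊔ (kernelChain S.E S.A (k + 1)).map S.A)
  have h₃ := finrank_range_sup_map_kernelChain S.E S.A k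
  have h₄ := finrank_range_sup_map_kernelChain S.E S.A (k + 1)
  have h₅ := S.alpha_succ_add_finrank k
  omega

end Defects

end LinearSystem

theorem theorem8p7 {K : Type u} [Field K] {M : Type v} {V : Type w}
    [AddCommGroup M] [Module K M] [FiniteDimensional K M]
    [AddCommGroup V] [Module K V] [FiniteDimensional K V]
    (E A : M →ₗ[K] V) :
    ∀ k : ℕ, 1 ≤ k →
      (LinearSystem.ofPair E.dualMap A.dualMap).alpha k = (LinearSystem.ofPair E A).alpha k ∧
      (LinearSystem.ofPair E.dualMap A.dualMap).betaPlus k =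
        (LinearSystem.ofPair E A).betaMinus k ∧
      (LinearSystem.ofPair E.dualMap A.dualMap).betaMinus k =
        (LinearSystem.ofPair E A).betaPlus k := by
  intro k hk
  obtain ⟨k, rfl⟩ := Nat.exists_eq_add_of_le' hk
  let S := LinearSystem.ofPair E A
  exact ⟨S.dual_alpha_succ k, (S.betaMinus_succ k).symm,
    (S.dual.betaMinus_succ k).trans (S.dual_dual_betaPlus_succ k)⟩
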